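/- Proposition 6.3 (fip* of $f_0$ for GNEP). Consider finitely many players $\nu=1,\dots,p$. For each $\nu$ let $X_\nu$ be a real topological vector space, put $X=\prod_{\nu=1}^p X_\nu$ with the product topology, and let $C\subseteq X$ be convex. For $x\in X$ write $x=(x^\nu,x^{-\nu})$, where $x^\nu\in X_\nu$ is the component of player $\nu$ and $x^{-\nu}$ is the vector of the components of all other players. Let $\theta_\nu:X\to\mathbb{R}$ $(\nu=1,\dots,p)$ be objective functions such that each $\theta_\nu$ is continuous on $X$ and, for every $y\in X$, the function $z\mapsto\theta_\nu(z,y^{-\nu})$ is convex on $X_\nu$. Define $f_0:X\times X\to\mathbb{R}$ by $$f_0(x,y)=\sum_{\nu=1}^p\bigl(\theta_\nu(y^\nu,y^{-\nu})-\theta_\nu(x^\nu,y^{-\nu})\bigr).$$ Then $f_0$ has the star finite intersection property (fip*) on $C$: for every finite non-empty set $A\subseteq C$ there exists a point $x$ in the convex hull of $A$ such that $$\max_{a\in A}f_0(a,x)\le 0.$$ -/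

import Mathlib

/-- A bifunction `f` on a real vector space has the star finite intersection property (fip*) on
the (convex) set `C`: every finite non-empty `A ⊆ C` has a point `x` in its convex hull with
`max_{a ∈ A} f a x ≤ 0`. -/
def HasFipStar {E : Type*} [AddCommGroup E] [Module ℝ E] (f : E → E → ℝ) (C : Set E) : Prop :=
  ∀ (A : Finset E) (hA : A.Nonempty), (A : Set E) ⊆ C →
    ∃ x ∈ convexHull ℝ (A : Set E), A.sup' hA (fun a => f a x) ≤ 0

/-- The Nikaidô–Isoda-type bifunction of a game with players `ν : ι`, strategy spaces `X ν` and
objectives `θ ν`: `f₀ x y = ∑ ν, (θ ν (y ν, y_{-ν}) - θ ν (x ν, y_{-ν}))`. The profile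
`(z, y_{-ν})` is `Function.update y ν z`, and `(y ν, y_{-ν})` is `y` itself. -/
def nikaidoIsoda {ι : Type*} [Fintype ι] [DecidableEq ι] {X : ι → Type*}
    (θ : ι → (∀ ν, X ν) → ℝ) (x y : ∀ ν, X ν) : ℝ :=
  ∑ ν, (θ ν y - θ ν (Function.update y ν (x ν)))

/-! In its first argument $f_0$ is a constant minus a sum of convex functions of single components,
hence concave; in its second it is continuous; and it vanishes on the diagonal. So the claim is an
instance of Ky Fan's inequality on the polytope $\mathrm{conv}\,A$
(`hasFipStar_of_concaveOn_of_continuous`). With $\mathrm{conv}\,A$ parametrised by a simplex,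
Jensen's inequality and the diagonal give the covering condition of KKM
(`exists_mem_stdSimplex_forall_nonpos`), which follows from a Brouwer-type statement
(`exists_mem_stdSimplex_mul_sum_le`). The latter is a limit of colourings of finer and finer grids.
Scarf's lemma, a parity argument on dominant sets, plays the role of Sperner's lemma there. -/

/-! ### Dominant sets and Scarf's lemma -/

/-- A set `σ` of points is dominant for the family of rankings `r` when no point is ranked
strictly above the minimum of `σ` by all rankings at once. -/
def IsDominant {P I L : Type*} [LinearOrder L] (r : I → P → L) (σ : Finset P) : Prop :=
  ∀ y, ∃ i, ∀ x ∈ σ, r i y ≤ r i x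

theorem IsDominant.mono {P I L : Type*} [LinearOrder L] {r : I → P → L} {σ τ : Finset P}
    (h : IsDominant r σ) (hτ : τ ⊆ σ) : IsDominant r τ := fun y =>
  let ⟨i, hi⟩ := h y
  ⟨i, fun x hx => hi x (hτ hx)⟩

/-- A nonempty dominant set with one point less than there are rankings, for which every ranking
admits a point above the minima of all other rankings, has exactly two dominant one-point
extensions. -/
theorem IsDominant.card_extensions {P I L : Type*} [Fintype P] [Fintype I] [DecidableEq P]
    [DecidableEq I] [LinearOrder L] {r : I → P → L} (hr : ∀ i, Function.Injective (r i))
    {τ : Finset P} (hτ : IsDominant r τ) (hcard : τ.card + 1 = Fintype.card I)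
    (hne : τ.Nonempty) (hup : ∀ a, ∃ y, ∀ i ≠ a, ∃ x ∈ τ, r i x < r i y)
    [DecidablePred fun x => x ∉ τ ∧ IsDominant r (insert x τ)] :
    (Finset.univ.filter fun x => x ∉ τ ∧ IsDominant r (insert x τ)).card = 2 := by
  classical
  choose m hmτ hmin using fun i => τ.exists_min_image (r i) hne
  have hsurj : ∀ t ∈ τ, ∃ i, m i = t := fun t ht => by
    obtain ⟨i, hi⟩ := hτ t
    exact ⟨i, hr i (le_antisymm (hmin i t ht) (hi _ (hmτ i)))⟩
  -- Every point of `τ` is the minimum of some ranking, and there is one ranking too many, so `a`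
  -- and `b` share a minimum.
  obtain ⟨a, -, b, -, hab, hmab⟩ : ∃ a ∈ (Finset.univ : Finset I), ∃ b ∈ (Finset.univ : Finset I),
      a ≠ b ∧ m a = m b :=
    Finset.exists_ne_map_eq_of_card_lt_of_maps_to (t := τ)
      (by rw [Finset.card_univ]; omega) (fun i _ => hmτ i)
  have hinj : ∀ k, (∀ t ∈ τ, ∃ i, i ≠ k ∧ m i = t) → ∀ i j, i ≠ k → j ≠ k → m i = m j → i = j := by
    intro k hk i j hi hj hij
    have himg : (Finset.univ.erase k).image m = τ := by
      ext t
      simp only [Finset.mem_image, Finset.mem_erase, Finset.mem_univ, and_true]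
      exact ⟨fun ⟨i, _, h⟩ => h ▸ hmτ i, hk t⟩
    have hinjOn : Set.InjOn m (Finset.univ.erase k : Finset I) := by
      rw [← Finset.card_image_iff, himg, Finset.card_erase_of_mem (Finset.mem_univ k),
        Finset.card_univ]
      omega
    exact hinjOn (by simpa using hi) (by simpa using hj) hij
  -- A new point must become the minimum of a ranking `k`. The points of `τ` need the other
  -- rankings, so `k` is `a` or `b`, and dominance forces the new point to be the `r k`-highest
  -- element `q k` of `M k`.
  let M : I → Finset P := fun k => Finset.univ.filter fun y => ∀ i ≠ k, r i (m i) < r i y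
  have hM : ∀ k, (M k).Nonempty := fun k => by
    obtain ⟨y, hy⟩ := hup k
    refine ⟨y, Finset.mem_filter.2 ⟨Finset.mem_univ _, fun i hi => ?_⟩⟩
    obtain ⟨x, hx, hxy⟩ := hy i hi
    exact (hmin i x hx).trans_lt hxy
  choose q hqM hqmax using fun k => (M k).exists_max_image (r k) (hM k)
  have hqlt : ∀ k, ∀ i ≠ k, r i (m i) < r i (q k) := fun k => (Finset.mem_filter.1 (hqM k)).2
  have hcover : ∀ k, k = a ∨ k = b → ∀ t ∈ τ, ∃ i, i ≠ k ∧ m i = t := by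
    rintro k hk t ht
    obtain ⟨i, hi⟩ := hsurj t ht
    by_cases hik : i = k
    · rcases hk with rfl | rfl
      · exact ⟨b, hab.symm, by rw [← hmab, ← hik, hi]⟩
      · exact ⟨a, hab, by rw [hmab, ← hik, hi]⟩
    · exact ⟨i, hik, hi⟩
  have hqab : q a ≠ q b := by
    intro h
    obtain ⟨i, hi⟩ := hτ (q a)
    have hlt : r i (m i) < r i (q a) := by
      by_cases hia : i = a
      · rw [h]; exact hqlt b i (by rw [hia]; exact hab)
      · exact hqlt a i hia
    exact absurd (hi _ (hmτ i)) (not_le.2 hlt)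
  have hext : ∀ k, k = a ∨ k = b → q k ∉ τ ∧ IsDominant r (insert (q k) τ) := by
    intro k hk
    refine ⟨fun hq => ?_, fun y => ?_⟩
    · obtain ⟨i, hik, hi⟩ := hcover k hk _ hq
      exact absurd (hqlt k i hik) (by rw [hi]; exact lt_irrefl _)
    · by_cases hy : ∀ i ≠ k, r i (m i) < r i y
      · have hyq := hqmax k y (Finset.mem_filter.2 ⟨Finset.mem_univ _, hy⟩)
        obtain ⟨i, hi⟩ := hτ (q k)
        have hik : i = k := by
          by_contra hik
          exact absurd (hi _ (hmτ i)) (not_le.2 (hqlt k i hik))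
        subst hik
        refine ⟨i, fun x hx => ?_⟩
        rcases Finset.mem_insert.1 hx with rfl | hx
        · exact hyq
        · exact hyq.trans (hi x hx)
      · push Not at hy
        obtain ⟨i, hik, hi⟩ := hy
        refine ⟨i, fun x hx => ?_⟩
        rcases Finset.mem_insert.1 hx with rfl | hx
        · exact hi.trans (hqlt k i hik).le
        · exact hi.trans (hmin i x hx)
  have huniq : ∀ x, x ∉ τ → IsDominant r (insert x τ) → x = q a ∨ x = q b := by
    intro x hx hdom
    obtain ⟨k, hk⟩ := hdom x
    have hlow : ∀ t ∈ τ, ∃ i, i ≠ k ∧ m i = t ∧ r i t < r i x := by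
      intro t ht
      obtain ⟨i, hi⟩ := hdom t
      have hne' : t ≠ x := fun h => hx (h ▸ ht)
      have hlt : r i t < r i x :=
        lt_of_le_of_ne (hi x (Finset.mem_insert_self _ _)) fun h => hne' (hr i h)
      refine ⟨i, ?_, hr i (le_antisymm (hmin i t ht) (hi _ (Finset.mem_insert_of_mem (hmτ i)))),
        hlt⟩
      rintro rfl
      exact absurd (hk t (Finset.mem_insert_of_mem ht)) (not_le.2 hlt)
    have hinjk := hinj k fun t ht =>
      let ⟨i, h1, h2, _⟩ := hlow t ht
      ⟨i, h1, h2⟩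
    have hxM : ∀ i ≠ k, r i (m i) < r i x := by
      intro i hik
      obtain ⟨j, hjk, hj, hlt⟩ := hlow (m i) (hmτ i)
      obtain rfl := hinjk j i hjk hik hj
      exact hlt
    have hkab : k = a ∨ k = b := by
      by_contra! h
      exact hab (hinjk a b h.1.symm h.2.symm hmab)
    have hxq : x = q k := by
      refine hr k (le_antisymm (hqmax k x (Finset.mem_filter.2 ⟨Finset.mem_univ _, hxM⟩)) ?_)
      obtain ⟨i, hi⟩ := hdom (q k)
      have hik : i = k := by
        by_contra hik
        exact absurd (hi _ (Finset.mem_insert_of_mem (hmτ i))) (not_le.2 (hqlt k i hik))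
      subst hik
      exact hi x (Finset.mem_insert_self _ _)
    rcases hkab with rfl | rfl
    · exact Or.inl hxq
    · exact Or.inr hxq
  rw [Finset.card_eq_two]
  refine ⟨q a, q b, hqab, ?_⟩
  ext x
  simp only [Finset.mem_filter, Finset.mem_univ, true_and, Finset.mem_insert,
    Finset.mem_singleton]
  constructor
  · exact fun h => huniq x h.1 h.2
  · rintro (rfl | rfl)
    · exact hext a (Or.inl rfl)
    · exact hext b (Or.inr rfl)

/-- If the colours of `R` do not exhaust `I`, the number of points of `R` whose removal leaves
exactly the colours other than `k` is even. -/
theorem even_card_erase_image_eq {P I : Type*} [Fintype I] [DecidableEq P] [DecidableEq I]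
    (c : P → I) (k : I) {R : Finset P} (hcard : R.card = Fintype.card I)
    (hR : R.image c ≠ Finset.univ) :
    Even (R.filter fun x => (R.erase x).image c = Finset.univ.erase k).card := by
  rcases (R.filter fun x => (R.erase x).image c = Finset.univ.erase k).eq_empty_or_nonempty with
    h | ⟨x, hx⟩
  · simp [h]
  obtain ⟨hxR, hx⟩ := Finset.mem_filter.1 hx
  have himg : R.image c = insert (c x) (Finset.univ.erase k) := by
    rw [← hx, ← Finset.image_insert, Finset.insert_erase hxR]
  have hck : c x ≠ k := by
    rintro rfl
    exact hR (by rw [himg, Finset.insert_erase (Finset.mem_univ _)])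
  -- The colour of `x` recurs at a single other point `x'`; removing either twin leaves the same
  -- colours, and removing any other point leaves a repetition.
  obtain ⟨x', hx'mem, hcx⟩ := Finset.mem_image.1
    (show c x ∈ (R.erase x).image c by rw [hx]; simpa using hck)
  obtain ⟨hx'x, hx'R⟩ := Finset.mem_erase.1 hx'mem
  have hinj : Set.InjOn c (R.erase x : Finset P) := by
    rw [← Finset.card_image_iff, hx, Finset.card_erase_of_mem (Finset.mem_univ k),
      Finset.card_univ, Finset.card_erase_of_mem hxR, hcard]
  suffices h : (R.filter fun y => (R.erase y).image c = Finset.univ.erase k) = {x, x'} by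
    rw [h, Finset.card_pair hx'x.symm]
    exact even_two
  ext y
  simp only [Finset.mem_filter, Finset.mem_insert, Finset.mem_singleton]
  constructor
  · rintro ⟨hyR, hy⟩
    by_contra! hne
    have hcy : c y ∈ (R.erase y).image c := by
      rw [hy, ← hx]
      exact Finset.mem_image_of_mem c (Finset.mem_erase.2 ⟨hne.1, hyR⟩)
    obtain ⟨z, hz, hzc⟩ := Finset.mem_image.1 hcy
    obtain ⟨hzy, hzR⟩ := Finset.mem_erase.1 hz
    by_cases hzx : z = x
    · subst hzx
      exact hne.2 (hinj (by simp [hne.1, hyR]) (Finset.mem_coe.2 hx'mem) (hzc.symm.trans hcx.symm))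
    · exact hzy (hinj (by simp [hzx, hzR]) (by simp [hne.1, hyR]) hzc)
  · rintro (rfl | rfl)
    · exact ⟨hxR, hx⟩
    · refine ⟨hx'R, ?_⟩
      have h1 : R.erase y = insert x ((R.erase x).erase y) := by
        rw [Finset.erase_right_comm, Finset.insert_erase (Finset.mem_erase.2 ⟨hx'x.symm, hxR⟩)]
      have h2 : R.erase x = insert y ((R.erase x).erase y) := by
        rw [Finset.insert_erase (Finset.mem_erase.2 ⟨hx'x, hx'R⟩)]
      rw [h1, Finset.image_insert, ← hcx, ← Finset.image_insert, ← h2, hx]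

/-- **Scarf's lemma** with slack points: the slack point `Sum.inr i` is the lowest one for the
ranking `i`, and is above all proper points for the other rankings. -/
theorem exists_isDominant_image_eq_univ {T I L : Type*} [Fintype T] [Nonempty T] [Fintype I]
    [Nonempty I] [DecidableEq T] [DecidableEq I] [LinearOrder L] (r : I → T ⊕ I → L)
    (hr : ∀ i, Function.Injective (r i)) (hbot : ∀ i y, r i (Sum.inr i) ≤ r i y)
    (htop : ∀ i j t, i ≠ j → r i (Sum.inl t) < r i (Sum.inr j)) (c : T → I) :
    ∃ R : Finset (T ⊕ I), IsDominant r R ∧ R.image (Sum.elim c id) = Finset.univ := by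
  classical
  by_contra! hno
  set c' : T ⊕ I → I := Sum.elim c id with hc'
  obtain ⟨k⟩ := ‹Nonempty I›
  let D : Finset (Finset (T ⊕ I)) := Finset.univ.filter fun τ =>
    τ.card + 1 = Fintype.card I ∧ τ.image c' = Finset.univ.erase k ∧ IsDominant r τ
  let Rm : Finset (Finset (T ⊕ I)) := Finset.univ.filter fun R =>
    R.card = Fintype.card I ∧ IsDominant r R
  -- Double counting of pairs `τ ⊂ R`, with `τ` carrying exactly the colours other than `k`. Without
  -- a fully coloured `R`, the right side is even; the left is odd because only the all-slack set
  -- `τ₀` has a single extension.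
  have hcount : ∑ τ ∈ D, (Finset.univ.filter fun x => x ∉ τ ∧ IsDominant r (insert x τ)).card =
      ∑ R ∈ Rm, (R.filter fun x => (R.erase x).image c' = Finset.univ.erase k).card := by
    rw [← Finset.card_sigma, ← Finset.card_sigma]
    refine Finset.card_nbij' (fun p => ⟨insert p.2 p.1, p.2⟩) (fun p => ⟨p.1.erase p.2, p.2⟩)
      ?_ ?_ ?_ ?_
    · rintro ⟨τ, x⟩ h
      simp only [Finset.coe_sigma, Set.mem_sigma_iff, Finset.mem_coe, Finset.mem_filter,
        Finset.mem_univ, true_and, D, Rm] at h ⊢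
      obtain ⟨⟨h1, h2, h3⟩, h4, h5⟩ := h
      refine ⟨⟨by rw [Finset.card_insert_of_notMem h4, h1], h5⟩, Finset.mem_insert_self _ _, ?_⟩
      rw [Finset.erase_insert h4, h2]
    · rintro ⟨R, x⟩ h
      simp only [Finset.coe_sigma, Set.mem_sigma_iff, Finset.mem_coe, Finset.mem_filter,
        Finset.mem_univ, true_and, D, Rm] at h ⊢
      obtain ⟨⟨h1, h2⟩, h3, h4⟩ := h
      refine ⟨⟨by rw [Finset.card_erase_add_one h3, h1], h4, h2.mono (Finset.erase_subset _ _)⟩,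
        Finset.notMem_erase _ _, ?_⟩
      rwa [Finset.insert_erase h3]
    · rintro ⟨τ, x⟩ h
      simp only [Finset.coe_sigma, Set.mem_sigma_iff, Finset.mem_coe, Finset.mem_filter,
        Finset.mem_univ, true_and] at h
      simp [Finset.erase_insert h.2.1]
    · rintro ⟨R, x⟩ h
      simp only [Finset.coe_sigma, Set.mem_sigma_iff, Finset.mem_coe, Finset.mem_filter] at h
      simp [Finset.insert_erase h.2.1]
  have heven : Even (∑ R ∈ Rm,
      (R.filter fun x => (R.erase x).image c' = Finset.univ.erase k).card) := by
    refine Finset.even_sum _ fun R hR => ?_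
    obtain ⟨h1, h2⟩ := (Finset.mem_filter.1 hR).2
    exact even_card_erase_image_eq c' k h1 (hno R h2)
  have hbot' : ∀ i t, r i (Sum.inr i) < r i (Sum.inl t) := fun i t =>
    lt_of_le_of_ne (hbot i _) fun h => Sum.inr_ne_inl (hr i h)
  let τ₀ : Finset (T ⊕ I) := (Finset.univ.erase k).image Sum.inr
  have hτ₀ : ∀ i, Sum.inr i ∈ τ₀ ↔ i ≠ k := by simp [τ₀]
  have hτ₀' : ∀ t, Sum.inl t ∉ τ₀ := by simp [τ₀]
  obtain ⟨t₀, -, ht₀⟩ := Finset.exists_max_image Finset.univ (fun t => r k (Sum.inl t))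
    Finset.univ_nonempty
  have hdom₀ : IsDominant r (insert (Sum.inl t₀) τ₀) := by
    rintro (t | j)
    · refine ⟨k, fun x hx => ?_⟩
      rcases Finset.mem_insert.1 hx with rfl | hx
      · exact ht₀ t (Finset.mem_univ _)
      · obtain ⟨i, hi, rfl⟩ := Finset.mem_image.1 hx
        exact (htop k i t (Finset.ne_of_mem_erase hi).symm).le
    · exact ⟨j, fun x _ => hbot j x⟩
  have hfirst : (Finset.univ.filter fun x => x ∉ τ₀ ∧ IsDominant r (insert x τ₀)).card = 1 := by
    rw [Finset.card_eq_one]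
    refine ⟨Sum.inl t₀, ?_⟩
    ext x
    simp only [Finset.mem_filter, Finset.mem_univ, true_and, Finset.mem_singleton]
    constructor
    · rintro ⟨hx, hdom⟩
      obtain ⟨i, hi⟩ := hdom (Sum.inl t₀)
      have hik : i = k := by
        by_contra hik
        exact absurd (hi _ (Finset.mem_insert_of_mem ((hτ₀ i).2 hik))) (not_le.2 (hbot' i t₀))
      subst hik
      have hx' := hi x (Finset.mem_insert_self _ _)
      rcases x with t | j
      · exact hr i (le_antisymm (ht₀ t (Finset.mem_univ _)) hx')
      · have hj : j = i := by simpa [hτ₀] using hx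
        subst hj
        exact absurd hx' (not_le.2 (hbot' j t₀))
    · rintro rfl
      exact ⟨hτ₀' t₀, hdom₀⟩
  have hmem : τ₀ ∈ D := by
    refine Finset.mem_filter.2 ⟨Finset.mem_univ _, ?_, ?_, hdom₀.mono (Finset.subset_insert _ _)⟩
    · rw [Finset.card_image_of_injective _ Sum.inr_injective,
        Finset.card_erase_add_one (Finset.mem_univ k), Finset.card_univ]
    · simp [τ₀, hc', Finset.image_image]
  have hrest : Even (∑ τ ∈ D.erase τ₀,
      (Finset.univ.filter fun x => x ∉ τ ∧ IsDominant r (insert x τ)).card) := by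
    refine Finset.even_sum _ fun τ hτ => ?_
    obtain ⟨hne, hτ⟩ := Finset.mem_erase.1 hτ
    obtain ⟨h1, h2, h3⟩ := (Finset.mem_filter.1 hτ).2
    obtain ⟨t, ht⟩ : ∃ t, Sum.inl t ∈ τ := by
      by_contra! hall
      refine hne (Finset.ext ?_)
      rintro (t | i)
      · simp [hall t, hτ₀' t]
      · have hi : i ∈ τ.image c' ↔ Sum.inr i ∈ τ := by
          rw [Finset.mem_image]
          constructor
          · rintro ⟨t | j, hx, hxi⟩
            · exact absurd hx (hall t)
            · have hji : j = i := hxi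
              exact hji ▸ hx
          · exact fun h => ⟨_, h, rfl⟩
        rw [← hi, h2, hτ₀]
        simp
    -- The slack point of `a` is above the proper point `t` in every ranking but `a`.
    rw [h3.card_extensions hr h1 ⟨_, ht⟩ fun a =>
      ⟨Sum.inr a, fun i hi => ⟨_, ht, htop i a t hi⟩⟩]
    exact even_two
  rw [← Finset.add_sum_erase D _ hmem, hfirst] at hcount
  rw [← hcount] at heven
  exact Nat.not_even_iff_odd.2 (odd_one.add_even hrest) heven

/-- **Scarf's lemma**: for finitely many functions `u i` on a finite set `T` and a colouring `c` of
`T` by the indices, some set `σ` is not dominated strictly by any point in all its colours. -/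
theorem exists_colored_dominant {T I : Type*} [Fintype T] [Nonempty T] [Fintype I] [DecidableEq I]
    (u : I → T → ℕ) (c : T → I) :
    ∃ σ : Finset T, ∀ y, ∃ i ∈ σ.image c, ∀ x ∈ σ, u i y ≤ u i x := by
  classical
  have : Nonempty I := ‹Nonempty T›.map c
  let e : T → ℕ := fun t => Fintype.equivFin T t
  have he : ∀ t, e t < Fintype.card T := fun t => (Fintype.equivFin T t).2
  have heinj : Function.Injective e :=
    Fin.val_injective.comp (Fintype.equivFin T).injective
  -- Ties of `u i` are broken by the enumeration `e`, whose values stay below the factor.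
  let v : I → T → ℕ := fun i t => u i t * Fintype.card T + e t
  have hvinj : ∀ i, Function.Injective (v i) := by
    intro i s t hst
    have h : (v i s) % Fintype.card T = (v i t) % Fintype.card T := by rw [hst]
    simp only [v, Nat.mul_add_mod_self_right, Nat.mod_eq_of_lt (he _)] at h
    exact heinj h
  have hvle : ∀ i s t, v i s ≤ v i t → u i s ≤ u i t := by
    intro i s t hst
    by_contra! hlt
    have h1 : (u i t + 1) * Fintype.card T ≤ u i s * Fintype.card T :=
      Nat.mul_le_mul_right _ hlt
    have h2 := he t
    simp only [v] at hst
    rw [Nat.add_mul] at h1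
    omega
  let B : ℕ := ∑ i, ∑ t, v i t
  have hB : ∀ i t, v i t ≤ B := fun i t =>
    (Finset.single_le_sum (f := fun t => v i t) (fun _ _ => Nat.zero_le _) (Finset.mem_univ t)).trans
      (Finset.single_le_sum (f := fun i => ∑ t, v i t) (fun _ _ => Nat.zero_le _)
        (Finset.mem_univ i))
  -- Proper points get values from `1` to `B + 1`, leaving `0` for the ranking's own slack point and
  -- `B + 2` upwards for the others.
  let r : I → T ⊕ I → ℕ := fun i => Sum.elim (fun t => v i t + 1)
    fun j => if j = i then 0 else B + 2 + Fintype.equivFin I j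
  have hbot : ∀ i y, r i (Sum.inr i) ≤ r i y := by simp [r]
  have htop : ∀ i j t, i ≠ j → r i (Sum.inl t) < r i (Sum.inr j) := by
    intro i j t hij
    have := hB i t
    simp only [r, Sum.elim_inl, Sum.elim_inr, if_neg hij.symm]
    omega
  have hr : ∀ i, Function.Injective (r i) := by
    rintro i (s | j) (t | l) h
    · simp only [r, Sum.elim_inl] at h
      exact congrArg _ (hvinj i (by omega))
    · have := hB i s
      simp only [r, Sum.elim_inl, Sum.elim_inr] at h
      split_ifs at h; omega
    · have := hB i t
      simp only [r, Sum.elim_inl, Sum.elim_inr] at h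
      split_ifs at h; omega
    · simp only [r, Sum.elim_inr] at h
      split_ifs at h with h1 h2 h2
      · rw [h1, h2]
      · omega
      · omega
      · exact congrArg _ ((Fintype.equivFin I).injective (Fin.ext (by omega)))
  obtain ⟨R, hdom, himg⟩ := exists_isDominant_image_eq_univ r hr hbot htop c
  refine ⟨Finset.univ.filter fun t => Sum.inl t ∈ R, fun y => ?_⟩
  obtain ⟨i, hi⟩ := hdom (Sum.inl y)
  refine ⟨i, ?_, fun x hx => hvle i y x ?_⟩
  · obtain ⟨t | j, hx, hxi⟩ := Finset.mem_image.1 (himg ▸ Finset.mem_univ i)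
    · exact Finset.mem_image.2 ⟨t, by simpa using hx, hxi⟩
    -- The slack point of `i` has rank `0`, below `y`, so it cannot supply the colour `i`.
    · have hj : j = i := hxi
      have := hi _ hx
      simp [r, hj] at this
  · simpa [r] using hi _ (Finset.mem_filter.1 hx).2

/-! ### From coloured grids to Brouwer's theorem -/

/-- For every colouring of the grid of integer points of the simplex of size `N` there is a grid
point `z` such that each colour either occurs close to `z` or has a small coordinate in `z`. -/
theorem exists_grid_point_near_colors {I : Type*} [Fintype I] [DecidableEq I] [Nonempty I] (N : ℕ)
    (c : {x : I → ℕ // ∑ i, x i = N} → I) :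
    ∃ z : {x : I → ℕ // ∑ i, x i = N}, ∀ i,
      (∃ w, c w = i ∧ ∀ j, w.1 j ≤ z.1 j + Fintype.card I ∧ z.1 j ≤ w.1 j + Fintype.card I) ∨
        z.1 i ≤ Fintype.card I := by
  classical
  have : Fintype {x : I → ℕ // ∑ i, x i = N} :=
    Fintype.ofFinset (p := {x : I → ℕ | ∑ i, x i = N}) (Finset.univ.piAntidiag N)
      (by simp [Finset.mem_piAntidiag])
  obtain ⟨i₀⟩ := ‹Nonempty I›
  have : Nonempty {x : I → ℕ // ∑ i, x i = N} := ⟨⟨fun i => if i = i₀ then N else 0, by simp⟩⟩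
  obtain ⟨σ, hσ⟩ := exists_colored_dominant (fun i (x : {x : I → ℕ // ∑ i, x i = N}) => x.1 i) c
  have hne : σ.Nonempty := by
    obtain ⟨i, hi, -⟩ := hσ (Classical.arbitrary _)
    exact Finset.image_nonempty.1 ⟨i, hi⟩
  choose m hmσ hmin using fun i => σ.exists_min_image (fun x => x.1 i) hne
  let s : I → ℕ := fun i => if i ∈ σ.image c then (m i).1 i + 1 else 0
  -- Otherwise a grid point above `s`, with the surplus placed on `i₀`, would beat the minimum of
  -- `σ` in every colour of `σ`.
  have hs : N < ∑ i, s i := by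
    by_contra! hle
    obtain ⟨i, hi, hiσ⟩ := hσ ⟨fun i => s i + if i = i₀ then N - ∑ i, s i else 0, by
      rw [Finset.sum_add_distrib]
      simp
      omega⟩
    have h := hiσ (m i) (hmσ i)
    simp only [s, if_pos hi] at h
    omega
  have hsle : ∀ x ∈ σ, ∀ i, s i ≤ x.1 i + 1 := by
    intro x hx i
    have := hmin i x hx
    simp only [s]
    split_ifs <;> omega
  have hles : ∀ x ∈ σ, ∀ i, x.1 i ≤ s i - 1 + Fintype.card I ∧ s i - 1 ≤ x.1 i := by
    intro x hx i
    have h1 := hsle x hx i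
    refine ⟨?_, by omega⟩
    -- The nonnegative gaps `x j + 1 - s j` add up to less than `Fintype.card I`, which bounds each
    -- of them.
    have h2 : ∑ j ∈ Finset.univ.erase i, s j ≤ ∑ j ∈ Finset.univ.erase i, (x.1 j + 1) :=
      Finset.sum_le_sum fun j _ => hsle x hx j
    rw [Finset.sum_add_distrib, Finset.sum_const, smul_eq_mul, mul_one] at h2
    have h3 := Finset.card_erase_add_one (Finset.mem_univ i)
    rw [Finset.card_univ] at h3
    have h4 := Finset.add_sum_erase _ (fun j => s j) (Finset.mem_univ i)
    have h5 := Finset.add_sum_erase _ (fun j => x.1 j) (Finset.mem_univ i)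
    have h6 := x.2
    omega
  obtain ⟨z, hz⟩ := hne
  refine ⟨z, fun i => ?_⟩
  by_cases hi : i ∈ σ.image c
  · obtain ⟨w, hw, hwi⟩ := Finset.mem_image.1 hi
    refine Or.inl ⟨w, hwi, fun j => ?_⟩
    have h1 := hles w hw j
    have h2 := hles z hz j
    omega
  · right
    have h1 := (hles z hz i).1
    simp only [s, if_neg hi] at h1
    omega

/-- A form of Brouwer's fixed point theorem on the standard simplex: the point `x` found is
fixed by the map `x ↦ (x + g x) / (1 + ∑ j, g j x)`. -/
theorem exists_mem_stdSimplex_mul_sum_le {I : Type*} [Fintype I] [Nonempty I]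
    (g : I → (I → ℝ) → ℝ) (hg : ∀ i, Continuous (g i)) (hg0 : ∀ i x, 0 ≤ g i x) :
    ∃ x ∈ stdSimplex ℝ I, ∀ i, x i * ∑ j, g j x ≤ g i x := by
  classical
  set n : ℝ := (Fintype.card I : ℝ) with hn
  have key : ∀ N : ℕ, ∃ a ∈ stdSimplex ℝ I, ∃ b : I → I → ℝ, ∀ i,
      dist (b i) a ≤ n / (N + 1) ∧ (b i i - n / (N + 1)) * ∑ j, g j (b i) ≤ g i (b i) := by
    intro N
    have hN : (0 : ℝ) < N + 1 := by positivity
    let p : {x : I → ℕ // ∑ i, x i = N + 1} → I → ℝ := fun x i => (x.1 i : ℝ) / (N + 1)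
    have hp : ∀ x, p x ∈ stdSimplex ℝ I := by
      intro x
      refine ⟨fun i => by positivity, ?_⟩
      rw [← Finset.sum_div, ← Nat.cast_sum, x.2]
      push_cast
      exact div_self hN.ne'
    -- If the inequality failed for all `i`, summing would give `∑ g < ∑ g`, as coordinates sum to
    -- one.
    have hcol : ∀ x, ∃ i, p x i * ∑ j, g j (p x) ≤ g i (p x) := by
      intro x
      by_contra! h
      have := Finset.sum_lt_sum_of_nonempty Finset.univ_nonempty fun i _ => h i
      rw [← Finset.sum_mul, (hp x).2, one_mul] at this
      exact lt_irrefl _ this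
    choose c hc using hcol
    have hn0 : 0 ≤ n / (N + 1) := by positivity
    obtain ⟨z, hz⟩ := exists_grid_point_near_colors (N + 1) c
    refine ⟨p z, hp z, ?_⟩
    have hG : ∀ x, 0 ≤ ∑ j, g j x := fun x => Finset.sum_nonneg fun j _ => hg0 j x
    suffices hex : ∀ i, ∃ b : I → ℝ, dist b (p z) ≤ n / (N + 1) ∧
        (b i - n / (N + 1)) * ∑ j, g j b ≤ g i b from
      ⟨fun i => (hex i).choose, fun i => (hex i).choose_spec⟩
    intro i
    rcases hz i with ⟨w, hw, hwz⟩ | hzi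
    · refine ⟨p w, (dist_pi_le_iff hn0).2 fun j => ?_, ?_⟩
      · obtain ⟨h1, h2⟩ := hwz j
        have h1' : (w.1 j : ℝ) ≤ z.1 j + n := by rw [hn]; exact_mod_cast h1
        have h2' : (z.1 j : ℝ) ≤ w.1 j + n := by rw [hn]; exact_mod_cast h2
        rw [Real.dist_eq, ← sub_div, abs_div, abs_of_pos hN]
        gcongr
        rw [abs_le]
        constructor <;> linarith
      · have h1 := hc w
        rw [hw] at h1
        refine le_trans (mul_le_mul_of_nonneg_right ?_ (hG _)) h1
        linarith
    -- A missing colour has a small coordinate at `z`, so the shifted left side is nonpositive.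
    · refine ⟨p z, by rw [dist_self]; exact hn0, ?_⟩
      refine le_trans (mul_nonpos_of_nonpos_of_nonneg ?_ (hG _)) (hg0 _ _)
      have h : (z.1 i : ℝ) ≤ n := by rw [hn]; exact_mod_cast hzi
      rw [sub_nonpos]
      exact div_le_div_of_nonneg_right h hN.le
  choose a ha b hb using key
  obtain ⟨x, hx, φ, hφ, hlim⟩ := (isCompact_stdSimplex ℝ I).tendsto_subseq ha
  refine ⟨x, hx, fun i => ?_⟩
  have h0 : Filter.Tendsto (fun k => n / ((φ k : ℝ) + 1)) Filter.atTop (nhds 0) := by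
    have h1 : Filter.Tendsto (fun N : ℕ => n * (1 / ((N : ℝ) + 1))) Filter.atTop (nhds 0) := by
      simpa using tendsto_one_div_add_atTop_nhds_zero_nat.const_mul n
    simpa [Function.comp_def, div_eq_mul_inv] using h1.comp hφ.tendsto_atTop
  have hbx : Filter.Tendsto (fun k => b (φ k) i) Filter.atTop (nhds x) := by
    rw [tendsto_iff_dist_tendsto_zero]
    refine squeeze_zero (fun _ => dist_nonneg)
      (fun k => (dist_triangle _ (a (φ k)) _).trans
        (add_le_add_left (hb (φ k) i).1 _)) ?_
    simpa using h0.add (tendsto_iff_dist_tendsto_zero.1 hlim)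
  have hl := ((((continuous_apply i).tendsto x).comp hbx).sub h0).mul
    (((continuous_finsetSum Finset.univ fun j _ => hg j).tendsto x).comp hbx)
  rw [sub_zero] at hl
  exact le_of_tendsto_of_tendsto' hl (((hg i).tendsto x).comp hbx) fun k => (hb (φ k) i).2

/-! ### KKM and Ky Fan's inequality -/

/-- **Knaster–Kuratowski–Mazurkiewicz**, for sublevel sets of continuous functions. -/
theorem exists_mem_stdSimplex_forall_nonpos {I : Type*} [Fintype I] [Nonempty I]
    (h : I → (I → ℝ) → ℝ) (hh : ∀ i, Continuous (h i))
    (hcov : ∀ x ∈ stdSimplex ℝ I, ∃ i, 0 < x i ∧ h i x ≤ 0) :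
    ∃ x ∈ stdSimplex ℝ I, ∀ i, h i x ≤ 0 := by
  obtain ⟨x, hx, hfix⟩ := exists_mem_stdSimplex_mul_sum_le (fun i x => max (h i x) 0)
    (fun i => (hh i).max continuous_const) fun i x => le_max_right _ _
  refine ⟨x, hx, ?_⟩
  -- Both sides have the same sum over `i`, so every inequality is an equality; the index `k` from
  -- the covering then forces the sum to vanish.
  have heq : ∀ i, x i * ∑ j, max (h j x) 0 = max (h i x) 0 := by
    have := (Finset.sum_eq_sum_iff_of_le fun i (_ : i ∈ Finset.univ) => hfix i).1
      (by rw [← Finset.sum_mul, hx.2, one_mul])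
    exact fun i => this i (Finset.mem_univ i)
  obtain ⟨k, hk, hkx⟩ := hcov x hx
  have hsum : ∑ j, max (h j x) 0 = 0 := by
    have := heq k
    rw [max_eq_right hkx] at this
    exact (mul_eq_zero.1 this).resolve_left hk.ne'
  intro i
  have := heq i
  rw [hsum, mul_zero] at this
  exact max_eq_right_iff.1 this.symm

/-- **Ky Fan's minimax inequality** on polytopes: a bifunction that is concave in the first
variable, continuous in the second and nonpositive on the diagonal has the star finite
intersection property. -/
theorem hasFipStar_of_concaveOn_of_continuous {E : Type*} [AddCommGroup E] [Module ℝ E]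
    [TopologicalSpace E] [ContinuousAdd E] [ContinuousSMul ℝ E] {f : E → E → ℝ}
    (hconc : ∀ y, ConcaveOn ℝ Set.univ fun x => f x y) (hcont : ∀ x, Continuous (f x))
    (hdiag : ∀ x, f x x ≤ 0) (C : Set E) : HasFipStar f C := by
  intro A hA _
  have : Nonempty A := hA.to_subtype
  let q : (A → ℝ) → E := fun w => ∑ a, w a • (a : E)
  have hq : Continuous q := by fun_prop
  have hcov : ∀ w ∈ stdSimplex ℝ A, ∃ a, 0 < w a ∧ f a (q w) ≤ 0 := by
    intro w hw
    -- Jensen and the diagonal bound the weighted mean of the values by `0`; positive values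
    -- wherever `w a > 0` would make all weights vanish.
    by_contra! hpos
    have hjensen : ∑ a, w a • f a (q w) ≤ f (q w) (q w) :=
      (hconc (q w)).le_map_sum (fun a _ => hw.1 a) hw.2 fun _ _ => Set.mem_univ _
    have hnonneg : ∀ a ∈ Finset.univ, 0 ≤ w a • f a (q w) := by
      intro a _
      rcases (hw.1 a).eq_or_lt with h | h
      · simp [← h]
      · exact (mul_pos h (hpos a h)).le
    have hzero := (Finset.sum_eq_zero_iff_of_nonneg hnonneg).1
      (le_antisymm (hjensen.trans (hdiag _)) (Finset.sum_nonneg hnonneg))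
    have hw0 : ∀ a, w a = 0 := by
      intro a
      by_contra h
      have h' := (hw.1 a).lt_of_ne' h
      exact (mul_pos h' (hpos a h')).ne' (hzero a (Finset.mem_univ a))
    have := hw.2
    simp [hw0] at this
  obtain ⟨w, hw, hle⟩ := exists_mem_stdSimplex_forall_nonpos (fun (a : A) w => f a (q w))
    (fun a => (hcont a).comp hq) hcov
  refine ⟨q w, ?_, (Finset.sup'_le_iff _ _).2 fun a ha => hle ⟨a, ha⟩⟩
  exact (convex_convexHull ℝ _).sum_mem (fun a _ => hw.1 a) hw.2
    fun a _ => subset_convexHull ℝ _ a.2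

/-! ### Concavity and continuity of the game bifunction -/

theorem concaveOn_nikaidoIsoda {ι : Type*} [Fintype ι] [DecidableEq ι] {X : ι → Type*}
    [∀ ν, AddCommGroup (X ν)] [∀ ν, Module ℝ (X ν)] {θ : ι → (∀ ν, X ν) → ℝ} {y : ∀ ν, X ν}
    (hθ : ∀ ν, ConvexOn ℝ Set.univ (fun z : X ν => θ ν (Function.update y ν z))) :
    ConcaveOn ℝ Set.univ fun x => nikaidoIsoda θ x y := by
  refine ⟨convex_univ, fun x _ x' _ s t hs ht hst => ?_⟩
  simp only [nikaidoIsoda, smul_eq_mul, Finset.mul_sum, ← Finset.sum_add_distrib]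
  refine Finset.sum_le_sum fun ν _ => ?_
  have h := (hθ ν).2 (Set.mem_univ (x ν)) (Set.mem_univ (x' ν)) hs ht hst
  simp only [smul_eq_mul] at h
  have hy : θ ν y = s * θ ν y + t * θ ν y := by rw [← add_mul, hst, one_mul]
  simp only [Pi.add_apply, Pi.smul_apply]
  linarith

theorem continuous_nikaidoIsoda {ι : Type*} [Fintype ι] [DecidableEq ι] {X : ι → Type*}
    [∀ ν, TopologicalSpace (X ν)] {θ : ι → (∀ ν, X ν) → ℝ} (hθ : ∀ ν, Continuous (θ ν))
    (x : ∀ ν, X ν) : Continuous (nikaidoIsoda θ x) :=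
  continuous_finsetSum _ fun ν _ =>
    (hθ ν).sub <| (hθ ν).comp <|
      (continuous_id (X := ∀ ν, X ν)).update ν (continuous_const (y := x ν))


theorem proposition6p3 {ι : Type*} [Fintype ι] [DecidableEq ι] {X : ι → Type*}
    [∀ ν, AddCommGroup (X ν)] [∀ ν, Module ℝ (X ν)] [∀ ν, TopologicalSpace (X ν)]
    [∀ ν, IsTopologicalAddGroup (X ν)] [∀ ν, ContinuousSMul ℝ (X ν)]
    (C : Set (∀ ν, X ν)) (hC : Convex ℝ C)
    (θ : ι → (∀ ν, X ν) → ℝ)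
    (hθ_cont : ∀ ν, Continuous (θ ν))
    (hθ_conv : ∀ ν (y : ∀ μ, X μ),
      ConvexOn ℝ Set.univ (fun z : X ν => θ ν (Function.update y ν z))) :
    HasFipStar (nikaidoIsoda θ) C := by
  have hconc := fun y => concaveOn_nikaidoIsoda fun ν => hθ_conv ν y
  have hcont := continuous_nikaidoIsoda hθ_cont
  have hdiag : ∀ x, nikaidoIsoda θ x x ≤ 0 := fun x => by simp [nikaidoIsoda]
  exact hasFipStar_of_concaveOn_of_continuous hconc hcont hdiag C
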